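/- All graphs are finite and simple. A pebbling move on a graph $G$ removes two pebbles from a vertex and places one pebble on an adjacent vertex. For a vertex $v$ of a connected graph $G$, let $f(G,v)$ be the least integer $k$ such that from every placement of $k$ pebbles on the vertices of $G$ some (possibly empty) sequence of pebbling moves puts at least one pebble on $v$, and let $f(G)=\max_{v} f(G,v)$ be the pebbling number of $G$. The middle graph $M(G)$ is obtained from $G$ by inserting a new vertex into each edge of $G$ and joining the new vertices of any two distinct edges of $G$ that share an endpoint. Let $C_k$ be the cycle on $k$ vertices, and let $G\times H$ be the Cartesian product, in which $(u_1,v_1)$ and $(u_2,v_2)$ are adjacent if and only if $u_1=u_2$ and $v_1v_2\in E(H)$, or $u_1u_2\in E(G)$ and $v_1=v_2$. Theorem. Let $m,n\ge 5$ be integers with $|n-m|\ge 2$. Then $$f\bigl(M(C_{2n})\times M(C_{2m})\bigr)\le f\bigl(M(C_{2n})\bigr)\,f\bigl(M(C_{2m})\bigr),$$ where $f(M(C_{2n}))=2^{n+1}+2n-2$ and $f(M(C_{2m}))=2^{m+1}+2m-2$. -/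

import Mathlib

/-- The middle graph of `G`: every edge of `G` is subdivided by a new vertex, and the new
vertices of two distinct edges are joined when these edges share an endpoint. -/
def SimpleGraph.middleGraph {V : Type*} (G : SimpleGraph V) :
    SimpleGraph (V ⊕ G.edgeSet) where
  Adj
    | .inl _, .inl _ => False
    | .inl v, .inr e => v ∈ (e : Sym2 V)
    | .inr e, .inl v => v ∈ (e : Sym2 V)
    | .inr e, .inr e' => e ≠ e' ∧ ∃ v, v ∈ (e : Sym2 V) ∧ v ∈ (e' : Sym2 V)
  symm := ⟨by
    rintro (v | e) (w | e') h
    · exact h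
    · exact h
    · exact h
    · exact ⟨h.1.symm, h.2.imp fun _ hv => hv.symm⟩⟩
  loopless := ⟨by
    rintro (v | e) h
    · exact h
    · exact h.1 rfl⟩

/-- `q` arises from the placement `p` by one pebbling move: two pebbles are taken off a vertex
`u` and one pebble is put on a vertex `w` adjacent to `u`. -/
def SimpleGraph.PebblingMove {V : Type*} (G : SimpleGraph V) (p q : V → ℕ) : Prop :=
  ∃ u w, G.Adj u w ∧ p u = q u + 2 ∧ q w = p w + 1 ∧ ∀ x, x ≠ u → x ≠ w → q x = p x

/-- Starting from the placement `p`, some sequence of pebbling moves puts a pebble on `v`. -/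
def SimpleGraph.CanPebble {V : Type*} (G : SimpleGraph V) (p : V → ℕ) (v : V) : Prop :=
  ∃ q, Relation.ReflTransGen G.PebblingMove p q ∧ 1 ≤ q v

/-- The pebbling number `f(G, v)` of the target vertex `v`: the least `k` such that a pebble can be
moved to `v` from every placement of `k` pebbles (`⊤` if there is no such `k`). -/
noncomputable def SimpleGraph.pebblingNumberAt {V : Type*} [Fintype V] (G : SimpleGraph V)
    (v : V) : ℕ∞ :=
  ⨅ (k : ℕ) (_ : ∀ p : V → ℕ, ∑ x, p x = k → G.CanPebble p v), (k : ℕ∞)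

/-- The pebbling number `f(G)`: the maximum of `f(G, v)` over all vertices `v`. -/
noncomputable def SimpleGraph.pebblingNumber {V : Type*} [Fintype V] (G : SimpleGraph V) : ℕ∞ :=
  ⨆ v, G.pebblingNumberAt v

/-! Upper bounds come from weight functions. If each weighted vertex other than the root has a
neighbour of at least twice its weight, a placement missing the root has weighted total at most the
sum of the non-root weights (`sum_weight_le_of_not_canPebble`). For every root, the middle graph of
the cycle of length `2 * n` is covered by a caterpillar along one half of the cycle and its mirror
image, which meet only at the root and at the antipodal far end. Weights doubling along the spine
dominate `capWeight`, and the two cap weights together count every vertex at least twice; this gives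
`2 ^ (n + 1) + 2 * n - 2`. The matching lower bound puts `2 ^ (n + 1) - 1` pebbles opposite the root
and one on each remaining original vertex; a potential that ignores single pebbles on the latter
shows that the root is missed.

In the product, `rowWeight h` doubles along row `h` and then up the column of the root. This path
contributes less than `2 ^ (n + m + 2)` besides the root, and all other weights at most `10 * n * 2
^ h`. Averaging over `h` with coefficients `2 ^ (m - h)` dominates the product of the cap weights
and replaces the factor `2 ^ h` by `2 * m + 2`. A placement missing the root thus has at most `2 ^
(n + m + 2) + 10 * n * (2 * m + 2)` pebbles. The product of the two pebbling numbers has the same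
leading term, and its cross terms exceed the rest. -/

namespace SimpleGraph

/-! ### Weight functions -/

section Weight

variable {V : Type*} {G : SimpleGraph V} {p q : V → ℕ} {v : V}

theorem CanPebble.of_pebblingMove (h : G.PebblingMove p q) (hq : G.CanPebble q v) :
    G.CanPebble p v := by
  obtain ⟨q', h', hv⟩ := hq
  exact ⟨q', .head h h', hv⟩

theorem canPebble_of_pos (h : 1 ≤ p v) : G.CanPebble p v := ⟨p, .refl, h⟩

theorem exists_pebblingMove {u w : V} (huw : G.Adj u w) (hu : 2 ≤ p u) :
    ∃ q, G.PebblingMove p q ∧ p u = q u + 2 ∧ q w = p w + 1 ∧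
      ∀ x, x ≠ u → x ≠ w → q x = p x := by
  classical
  refine ⟨fun x => if x = u then p u - 2 else if x = w then p w + 1 else p x, ?_⟩
  have key : p u = (if u = u then p u - 2 else if u = w then p w + 1 else p u) + 2 ∧
      (if w = u then p u - 2 else if w = w then p w + 1 else p w) = p w + 1 ∧
      ∀ x, x ≠ u → x ≠ w →
        (if x = u then p u - 2 else if x = w then p w + 1 else p x) = p x := by
    refine ⟨?_, ?_, fun x h1 h2 => ?_⟩
    · rw [if_pos rfl]; omega
    · rw [if_neg huw.ne', if_pos rfl]
    · rw [if_neg h1, if_neg h2]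
  exact ⟨⟨u, w, huw, key⟩, key⟩

/-- The weight function lemma: if every weighted point other than the root has a neighbour of at
least twice its weight, then the total weight of a placement that does not reach the root is at
most the weight of the placement with one pebble on each point other than the root. -/
theorem sum_weight_le_of_not_canPebble {X : Type*} [Fintype X] {φ : X → V}
    (hφ : Function.Injective φ) (x₀ : X) (w : X → ℕ)
    (hw : ∀ x ≠ x₀, w x ≠ 0 → ∃ y, G.Adj (φ x) (φ y) ∧ 2 * w x ≤ w y)
    (hp : ¬ G.CanPebble p (φ x₀)) :
    ∑ x, w x * p (φ x) + w x₀ ≤ ∑ x, w x := by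
  classical
  induction hN : ∑ x, p (φ x) using Nat.strong_induction_on generalizing p with
  | _ N ih =>
  by_contra! hlt
  have h0 : p (φ x₀) = 0 := by
    by_contra h
    exact hp (canPebble_of_pos (Nat.one_le_iff_ne_zero.2 h))
  -- Pigeonhole: the root carries no pebble, so excess weight forces a non-root vertex with at least
  -- two pebbles. Moving them to its heavier neighbour loses no weight and uses up a pebble, so
  -- induction on the number of pebbles applies.
  obtain ⟨x, hx⟩ : ∃ x, w x < w x * p (φ x) + if x = x₀ then w x₀ else 0 := by
    by_contra! hall
    have := Finset.sum_le_sum fun x (_ : x ∈ Finset.univ) => hall x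
    rw [Finset.sum_add_distrib] at this
    simp only [Finset.sum_ite_eq', Finset.mem_univ, if_true] at this
    omega
  have hx0 : x ≠ x₀ := by
    rintro rfl
    simp [h0] at hx
  rw [if_neg hx0, add_zero] at hx
  have hwx : w x ≠ 0 := by
    intro h
    simp [h] at hx
  have hpx : 2 ≤ p (φ x) := by
    by_contra! h
    have : w x * p (φ x) ≤ w x * 1 := Nat.mul_le_mul_left _ (by omega)
    omega
  obtain ⟨y, hadj, hy⟩ := hw x hx0 hwx
  obtain ⟨q, hmove, hq1, hq2, hq3⟩ := exists_pebblingMove hadj hpx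
  have hq : ∀ z, q (φ z) + (if z = x then 2 else 0) = p (φ z) + if z = y then 1 else 0 := by
    intro z
    have hxy : x ≠ y := fun h => hadj.ne (congrArg φ h)
    by_cases hzx : z = x
    · subst hzx
      simp [hxy, hq1]
    · by_cases hzy : z = y
      · subst hzy
        simp [hzx, hq2]
      · simp [hzx, hzy, hq3 (φ z) (fun h => hzx (hφ h)) (fun h => hzy (hφ h))]
  have hcount : ∑ z, q (φ z) + 2 = ∑ z, p (φ z) + 1 := by
    have := Finset.sum_congr rfl fun z (_ : z ∈ Finset.univ) => hq z
    simpa [Finset.sum_add_distrib] using this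
  have hweight : ∑ z, w z * q (φ z) + w x * 2 = ∑ z, w z * p (φ z) + w y := by
    have := Finset.sum_congr rfl fun z (_ : z ∈ Finset.univ) => congrArg (w z * ·) (hq z)
    simpa [Finset.sum_add_distrib, mul_add] using this
  have := ih _ (by omega) (fun h => hp (h.of_pebblingMove hmove)) rfl
  omega

end Weight

end SimpleGraph

/-! ### Caterpillars and their weights -/

/-- The vertices of a caterpillar: the spine `inl t`, numbered from the far end `inl 0` to the root
`inl (n + 1)`, and a pendant vertex `inr j` at the spine vertex `inl (j + 2)` for `j < n - 1`. -/
abbrev Caterpillar (n : ℕ) : Type := Fin (n + 2) ⊕ Fin (n - 1)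

namespace Caterpillar

variable {n : ℕ}

/-- The root of the caterpillar. -/
def root (n : ℕ) : Caterpillar n := .inl (Fin.last (n + 1))

/-- The weight that is `1` on the far end of the caterpillar and `2` elsewhere. -/
def capWeight : Caterpillar n → ℕ
  | .inl t => if t.val = 0 then 1 else 2
  | .inr _ => 2

/-- The weight on a caterpillar that doubles along the spine. -/
def spineWeight : Caterpillar n → ℕ
  | .inl t => 2 ^ t.val
  | .inr _ => 2

/-- The weight `2 ^ height`, cut off above the spine vertex `h`. -/
def cutWeight (h : ℕ) : Caterpillar n → ℕ
  | .inl b => if b.val ≤ h then 2 ^ b.val else 0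
  | .inr j => if j.val + 1 < h then 2 ^ (j.val + 1) else 0

/-- The weight on a product of caterpillars whose heavy path runs along the row of the spine vertex
`h` of the second factor and then along the spine of the second factor. -/
def rowWeight {n m : ℕ} (h : ℕ) : Caterpillar n × Caterpillar m → ℕ
  | (.inl t, .inl b) =>
      if b.val < h then (if t.val = 0 then 1 else 2) * 2 ^ b.val
      else if b.val = h then 2 ^ (t.val + h)
      else if t.val = n + 1 then 2 ^ (n + 1 + b.val) else 0
  | (.inl t, .inr j) => if j.val + 1 < h then (if t.val = 0 then 1 else 2) * 2 ^ (j.val + 1) else 0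
  | (.inr _, .inl b) => if b.val ≤ h then 2 ^ (b.val + 1) else 0
  | (.inr _, .inr j) => if j.val + 1 < h then 2 ^ (j.val + 2) else 0

theorem ite_le_two_pow (t : ℕ) : (if t = 0 then 1 else 2) ≤ 2 ^ t := by
  split_ifs with h
  · simp [h]
  · calc 2 = 2 ^ 1 := rfl
      _ ≤ 2 ^ t := Nat.pow_le_pow_right (by norm_num) (by omega)

/-- Transfers averages: once a combination of the `cutWeight h` dominates `capWeight` on the second
factor, the same combination of the `rowWeight h` dominates the product of the cap weights. -/
theorem capWeight_mul_cutWeight_le {m : ℕ} (h : ℕ) (x : Caterpillar n) (y : Caterpillar m) :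
    capWeight x * cutWeight h y ≤ rowWeight h (x, y) := by
  rcases x with t | i <;> rcases y with b | j <;> simp only [capWeight, cutWeight, rowWeight]
  · rcases lt_trichotomy b.val h with hb | hb | hb
    · rw [if_pos hb.le, if_pos hb]
    · rw [if_pos hb.le, if_neg hb.not_lt, if_pos hb, hb, pow_add]
      exact Nat.mul_le_mul_right _ (ite_le_two_pow _)
    · rw [if_neg hb.not_ge, mul_zero]
      exact Nat.zero_le _
  · split_ifs <;> simp
  · split_ifs
    · rw [pow_succ, mul_comm]
    · simp
  · split_ifs
    · rw [pow_succ _ (j.val + 1), mul_comm]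
    · simp

theorem sum_range_ite_lt_two_pow_le (M k : ℕ) :
    ∑ b ∈ Finset.range M, (if b < k then 2 ^ b else 0) ≤ 2 ^ k := by
  rw [← Finset.sum_filter]
  calc ∑ b ∈ Finset.range M with b < k, 2 ^ b ≤ ∑ b ∈ Finset.range k, 2 ^ b :=
        Finset.sum_le_sum_of_subset fun b hb => by simpa using (Finset.mem_filter.1 hb).2
    _ ≤ 2 ^ k := (Nat.geomSum_lt le_rfl (by simp)).le

theorem sum_range_two_pow_add_one (k : ℕ) : ∑ b ∈ Finset.range k, 2 ^ b + 1 = 2 ^ k := by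
  induction k with
  | zero => rfl
  | succ k ih => rw [Finset.sum_range_succ, pow_succ]; omega

theorem sum_range_cap (k : ℕ) :
    ∑ t ∈ Finset.range (k + 1), (if t = 0 then 1 else 2) = 2 * k + 1 := by
  rw [Finset.sum_range_succ']
  simp [mul_comm]

theorem sum_spineWeight (hn : 1 ≤ n) :
    ∑ x : Caterpillar n, spineWeight x + 3 = 2 ^ (n + 2) + 2 * n := by
  rw [Fintype.sum_sum_type]
  simp only [spineWeight]
  rw [Fin.sum_univ_eq_sum_range (fun t => 2 ^ t) (n + 2)]
  have := sum_range_two_pow_add_one (n + 2)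
  simp
  omega

/-- Past row `h` only the root column is weighted, and it contributes the geometric sum `2 ^ (n + m
+ 3) - 2 ^ (n + h + 2)`; the subtracted term stands on the left. -/
theorem sum_row_spine_le {h m : ℕ} (hm : h ≤ m + 1) (n t : ℕ) :
    ∑ b ∈ Finset.range (m + 2), (if b < h then (if t = 0 then 1 else 2) * 2 ^ b
      else if b = h then 2 ^ (t + h) else if t = n + 1 then 2 ^ (n + 1 + b) else 0)
      + (if t = n + 1 then 2 ^ (n + h + 2) else 0)
    ≤ (if t = 0 then 1 else 2) * 2 ^ h + 2 ^ (t + h)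
      + (if t = n + 1 then 2 ^ (n + m + 3) else 0) := by
  obtain ⟨d, hd⟩ := Nat.exists_eq_add_of_le hm
  have hd' : m + 2 = h + 1 + d := by omega
  have hd'' : n + m + 3 = n + h + 2 + d := by omega
  rw [hd', hd'']
  clear hd' hd'' hd hm
  induction d with
  | zero =>
    rw [add_zero, Finset.sum_range_succ, if_neg (lt_irrefl _), if_pos rfl, add_zero]
    gcongr
    rw [Finset.sum_congr rfl fun b hb => if_pos (Finset.mem_range.1 hb), ← Finset.mul_sum]
    exact Nat.mul_le_mul_left _ (Nat.le.intro (sum_range_two_pow_add_one h))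
  | succ d ih =>
    rw [← add_assoc, Finset.sum_range_succ, if_neg (show ¬ h + 1 + d < h by omega),
      if_neg (show h + 1 + d ≠ h by omega), show n + 1 + (h + 1 + d) = n + h + 2 + d by omega,
      show n + h + 2 + (d + 1) = n + h + 2 + d + 1 by omega, pow_succ _ (n + h + 2 + d)]
    generalize (∑ b ∈ Finset.range (h + 1 + d), _ : ℕ) = S at ih ⊢
    generalize (if t = 0 then 1 else 2) * 2 ^ h = T at ih ⊢
    by_cases ht : t = n + 1
    · simp only [if_pos ht] at ih ⊢
      generalize 2 ^ (n + h + 2) = U at ih ⊢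
      omega
    · simpa only [if_neg ht] using ih

/-- The heavy path carries the powers from `2 ^ h` to `2 ^ (n + m + 2)`, with sum `2 ^ (n + m + 3) -
2 ^ h`. One of the two terms `2 ^ (n + m + 2)` is the root's own weight and cancels later; the
remaining vertices add at most `10 * n * 2 ^ h`. -/
theorem sum_rowWeight_le {m h : ℕ} (hn : 1 ≤ n) (hm : h ≤ m + 1) :
    ∑ x : Caterpillar n × Caterpillar m, rowWeight h x ≤
      2 ^ (n + m + 2) + 10 * n * 2 ^ h + 2 ^ (n + m + 2) := by
  rw [Fintype.sum_prod_type, Fintype.sum_sum_type]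
  simp only [Fintype.sum_sum_type, rowWeight, Finset.sum_add_distrib]
  have hrow : ∀ t : Fin (n + 2), (∑ b : Fin (m + 2),
      if b.val < h then (if t.val = 0 then 1 else 2) * 2 ^ b.val
      else if b.val = h then 2 ^ (t.val + h)
      else if t.val = n + 1 then 2 ^ (n + 1 + b.val) else 0) = _ := fun t =>
    Fin.sum_univ_eq_sum_range (fun b => if b < h then (if t.val = 0 then 1 else 2) * 2 ^ b
      else if b = h then 2 ^ (t.val + h)
      else if t.val = n + 1 then 2 ^ (n + 1 + b) else 0) (m + 2)
  have hrow' : ∀ t : Fin (n + 2), (∑ j : Fin (m - 1),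
      if j.val + 1 < h then (if t.val = 0 then 1 else 2) * 2 ^ (j.val + 1) else 0) = _ := fun t =>
    Fin.sum_univ_eq_sum_range (fun j =>
      if j + 1 < h then (if t.val = 0 then 1 else 2) * 2 ^ (j + 1) else 0) (m - 1)
  simp only [hrow, hrow',
    Fin.sum_univ_eq_sum_range (fun b => if b ≤ h then 2 ^ (b + 1) else 0) (m + 2),
    Fin.sum_univ_eq_sum_range (fun j => if j + 1 < h then 2 ^ (j + 2) else 0) (m - 1)]
  rw [Fin.sum_univ_eq_sum_range (fun t => ∑ b ∈ Finset.range (m + 2),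
      if b < h then (if t = 0 then 1 else 2) * 2 ^ b
      else if b = h then 2 ^ (t + h) else if t = n + 1 then 2 ^ (n + 1 + b) else 0) (n + 2),
    Fin.sum_univ_eq_sum_range (fun t => ∑ j ∈ Finset.range (m - 1),
      if j + 1 < h then (if t = 0 then 1 else 2) * 2 ^ (j + 1) else 0) (n + 2)]
  have hss := Finset.sum_le_sum fun t (_ : t ∈ Finset.range (n + 2)) => sum_row_spine_le hm n t
  simp only [Finset.sum_add_distrib, ← Finset.sum_mul, sum_range_cap (n + 1), pow_add _ _ h,
    Finset.sum_ite_eq', Finset.mem_range, show n + 1 < n + 2 by omega, if_true] at hss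
  have hgeo := sum_range_two_pow_add_one (n + 2)
  have hleaf : ∀ c : ℕ, ∑ j ∈ Finset.range (m - 1), (if j + 1 < h then c * 2 ^ (j + 1) else 0)
      ≤ c * 2 ^ h := by
    intro c
    calc _ = c * ∑ j ∈ Finset.range (m - 1), (if j + 1 < h then 2 ^ (j + 1) else 0) := by
          rw [Finset.mul_sum]
          exact Finset.sum_congr rfl fun j _ => by split_ifs <;> simp
      _ ≤ c * ∑ j ∈ Finset.range (m - 1 + 1), (if j < h then 2 ^ j else 0) := by
          rw [Finset.sum_range_succ']
          exact Nat.mul_le_mul_left _ (Nat.le_add_right _ _)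
      _ ≤ c * 2 ^ h := Nat.mul_le_mul_left _ (sum_range_ite_lt_two_pow_le _ _)
  have hsl := Finset.sum_le_sum fun t (_ : t ∈ Finset.range (n + 2)) =>
    hleaf (if t = 0 then 1 else 2)
  rw [← Finset.sum_mul, sum_range_cap (n + 1)] at hsl
  have hls : ∑ b ∈ Finset.range (m + 2), (if b ≤ h then 2 ^ (b + 1) else 0) ≤ 4 * 2 ^ h := by
    calc _ = 2 * ∑ b ∈ Finset.range (m + 2), (if b < h + 1 then 2 ^ b else 0) := by
          rw [Finset.mul_sum]
          refine Finset.sum_congr rfl fun b _ => ?_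
          simp only [Nat.lt_succ_iff]
          split_ifs
          · rw [pow_succ, mul_comm]
          · simp
      _ ≤ 2 * 2 ^ (h + 1) := Nat.mul_le_mul_left _ (sum_range_ite_lt_two_pow_le _ _)
      _ = 4 * 2 ^ h := by ring
  have hll : ∑ j ∈ Finset.range (m - 1), (if j + 1 < h then 2 ^ (j + 2) else 0) ≤ 2 * 2 ^ h := by
    refine le_trans (Finset.sum_le_sum fun j _ => ?_) (hleaf 2)
    split_ifs
    · rw [pow_succ _ (j + 1), mul_comm]
    · exact le_rfl
  simp only [Finset.sum_const, Finset.card_univ, Fintype.card_fin, smul_eq_mul]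
  obtain ⟨k, rfl⟩ : ∃ k, n = k + 1 := ⟨n - 1, by omega⟩
  rw [Nat.add_sub_cancel]
  have hls' := Nat.mul_le_mul_left k hls
  have hll' := Nat.mul_le_mul_left k hll
  -- The row sum is `2 ^ (n + h + 2) - 2 ^ h`, and its first term cancels the one that the column
  -- sum left on the other side.
  have hrhs : (2 * (k + 1 + 1) + 1) * 2 ^ h + (∑ i ∈ Finset.range (k + 1 + 2), 2 ^ i) * 2 ^ h
      + 2 ^ (k + 1 + m + 3)
      = (2 * k + 4) * 2 ^ h + 2 ^ (k + 1 + m + 3) + 2 ^ (k + 1 + h + 2) := by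
    rw [show k + 1 + h + 2 = k + 1 + 2 + h by omega, pow_add _ (k + 1 + 2) h, ← hgeo]
    ring
  have hss' := Nat.le_of_add_le_add_right (hss.trans_eq hrhs)
  simp only [pow_add _ _ h] at hss' ⊢
  refine (add_le_add (add_le_add hss' hsl) (add_le_add hls' hll')).trans ?_
  rw [pow_succ _ (k + 1 + m + 2)]
  nlinarith [Nat.zero_le (2 ^ h)]

end Caterpillar

/-! ### Averaging over the rows -/

namespace Caterpillar

/-- Truncated subtraction gives `h = m` and `h = m + 1` the same coefficient `1`, which makes the
geometric sum an exact power of two. -/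
theorem sum_Ico_two_pow_sub {k m : ℕ} (hk : k ≤ m + 1) :
    ∑ h ∈ Finset.Ico k (m + 2), 2 ^ (m - h) = 2 ^ (m + 1 - k) := by
  obtain ⟨d, hd⟩ := Nat.exists_eq_add_of_le hk
  induction d generalizing k with
  | zero =>
    obtain rfl : k = m + 1 := by omega
    rw [Finset.sum_eq_sum_Ico_succ_bot (by omega), show m - (m + 1) = 0 by omega]
    simp
  | succ d ih =>
    rw [Finset.sum_eq_sum_Ico_succ_bot (by omega), ih (by omega) (by omega),
      show m + 1 - k = m - k + 1 by omega, show m + 1 - (k + 1) = m - k by omega, pow_succ]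
    omega

theorem two_pow_mul_le_sum_ite {k l m c : ℕ} (h2 : 2 ≤ k) (hk : k ≤ m + 1)
    (hc : c ≤ 2 ^ (m + 1 - k) * 2 ^ l) :
    c ≤ ∑ h ∈ Finset.Ico 2 (m + 2), 2 ^ (m - h) * (if k ≤ h then 2 ^ l else 0) := by
  refine hc.trans ?_
  rw [← sum_Ico_two_pow_sub hk, Finset.sum_mul]
  refine le_trans (Finset.sum_le_sum fun h hh => ?_)
    (Finset.sum_le_sum_of_subset (Finset.Ico_subset_Ico_left h2))
  rw [if_pos (Finset.mem_Ico.1 hh).1]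

/-- A vertex of weight `2 ^ l` that is counted from row `k` on receives `2 ^ (m + 1 - k) * 2 ^ l` in
total. This is tight at the leaves (`l = j + 1`, `k = j + 2`) and at the spine vertices `0` and `1`,
where `k = 2` because the range starts there. -/
theorem le_sum_cutWeight {m : ℕ} (hm : 1 ≤ m) (y : Caterpillar m) :
    2 ^ (m - 1) * capWeight y ≤ ∑ h ∈ Finset.Ico 2 (m + 2), 2 ^ (m - h) * cutWeight h y := by
  have hone : 2 ^ (m - 1) * 2 = 2 ^ m := by rw [← pow_succ]; congr 1; omega
  rcases y with b | j
  · have hb := b.isLt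
    rcases Nat.lt_or_ge b.val 2 with hb2 | hb2
    · have hle : 2 ^ (m - 1) * capWeight (.inl b : Caterpillar m) ≤
          2 ^ (m + 1 - 2) * 2 ^ b.val := by
        refine Nat.mul_le_mul_left _ (ite_le_two_pow _)
      refine (two_pow_mul_le_sum_ite le_rfl (by omega) hle).trans
        (Finset.sum_le_sum fun h hh => ?_)
      have := (Finset.mem_Ico.1 hh).1
      simp only [cutWeight]
      rw [if_pos this, if_pos (by omega)]
    · simp only [cutWeight, capWeight]
      rw [if_neg (by omega)]
      refine two_pow_mul_le_sum_ite hb2 (by omega) ?_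
      rw [hone, ← pow_add]
      exact Nat.pow_le_pow_right (by norm_num) (by omega)
  · simp only [cutWeight, capWeight]
    refine two_pow_mul_le_sum_ite (k := j.val + 2) (by omega) (by omega) ?_
    rw [hone, ← pow_add]
    exact Nat.pow_le_pow_right (by norm_num) (by omega)

theorem sum_Ico_two_pow_sub_mul_two_pow {m : ℕ} (hm : 1 ≤ m) :
    ∑ h ∈ Finset.Ico 2 (m + 2), 2 ^ (m - h) * 2 ^ h = 2 ^ (m - 1) * (2 * m + 2) := by
  -- The top term `h = m + 1` contributes `2 ^ (m + 1)` by truncation, every other term `2 ^ m`.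
  rw [Finset.sum_Ico_succ_top (by omega),
    Finset.sum_congr rfl (g := fun _ => 2 ^ m) fun h hh => by
      rw [← pow_add, Nat.sub_add_cancel (by have := Finset.mem_Ico.1 hh; omega)]]
  obtain ⟨k, rfl⟩ : ∃ k, m = k + 1 := ⟨m - 1, by omega⟩
  simp
  ring

end Caterpillar

/-! ### Pebbling bounds from caterpillar covers -/

namespace SimpleGraph

open Caterpillar

/-- The map `φ` embeds the caterpillar into `G`, with root `r`. -/
structure IsCaterpillar {V : Type*} (G : SimpleGraph V) (r : V) {n : ℕ} (φ : Caterpillar n → V) :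
    Prop where
  injective : Function.Injective φ
  map_root : φ (root n) = r
  adj_spine : ∀ t (ht : t < n + 1), G.Adj (φ (.inl ⟨t, by omega⟩)) (φ (.inl ⟨t + 1, by omega⟩))
  adj_leaf : ∀ j : Fin (n - 1), G.Adj (φ (.inr j)) (φ (.inl ⟨j.val + 2, by omega⟩))

/-- Two caterpillars with root `r` cover the vertices of `G`, and share their far ends if these
are not covered otherwise. -/
def HasCaterpillarCover {V : Type*} (G : SimpleGraph V) (r : V) (n : ℕ) : Prop :=
  ∃ φ : Bool → Caterpillar n → V, (∀ τ, G.IsCaterpillar r (φ τ)) ∧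
    ∀ g, (∃ τ x, φ τ x = g ∧ capWeight x = 2) ∨ ∀ τ, φ τ (.inl 0) = g

variable {V W : Type*} {G : SimpleGraph V} {H : SimpleGraph W} {n m : ℕ}

/-- A vertex collects weight `2` either from one caterpillar or, as the common far end, as `1 + 1`.
-/
theorem two_mul_sum_le_of_cover [Fintype V] {φ : Bool → Caterpillar n → V}
    (hφ : ∀ g, (∃ τ x, φ τ x = g ∧ capWeight x = 2) ∨ ∀ τ, φ τ (.inl 0) = g) (f : V → ℕ) :
    2 * ∑ g, f g ≤ ∑ τ, ∑ x, capWeight x * f (φ τ x) := by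
  classical
  have hcov : ∀ g, 2 ≤ ∑ τ, ∑ x, if φ τ x = g then capWeight x else 0 := by
    intro g
    rcases hφ g with ⟨τ, x, hx, hc⟩ | h
    · calc 2 = if φ τ x = g then capWeight x else 0 := by rw [if_pos hx, hc]
        _ ≤ ∑ x, if φ τ x = g then capWeight x else 0 :=
          Finset.single_le_sum (f := fun x => if φ τ x = g then capWeight x else 0)
            (fun _ _ => Nat.zero_le _) (Finset.mem_univ x)
        _ ≤ _ := Finset.single_le_sum (f := fun τ => ∑ x, if φ τ x = g then capWeight x else 0)
            (fun _ _ => Nat.zero_le _) (Finset.mem_univ τ)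
    · calc 2 = ∑ _τ : Bool, 1 := by simp
        _ ≤ _ := Finset.sum_le_sum fun τ _ => by
          calc 1 = if φ τ (.inl 0) = g then capWeight (.inl 0 : Caterpillar n) else 0 := by
                rw [if_pos (h τ)]; rfl
            _ ≤ _ := Finset.single_le_sum (f := fun x => if φ τ x = g then capWeight x else 0)
                (fun _ _ => Nat.zero_le _) (Finset.mem_univ _)
  calc 2 * ∑ g, f g ≤ ∑ g, (∑ τ, ∑ x, if φ τ x = g then capWeight x else 0) * f g := by
        rw [Finset.mul_sum]
        exact Finset.sum_le_sum fun g _ => Nat.mul_le_mul_right _ (hcov g)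
    _ = ∑ τ, ∑ x, capWeight x * f (φ τ x) := by
        simp only [Finset.sum_mul, ite_mul, zero_mul]
        rw [Finset.sum_comm]
        refine Finset.sum_congr rfl fun τ _ => ?_
        rw [Finset.sum_comm]
        refine Finset.sum_congr rfl fun x _ => ?_
        simp

/-- `spineWeight` dominates `capWeight` and doubles towards the root; the bound is its total without
the root's `2 ^ (n + 1)`. -/
theorem IsCaterpillar.sum_capWeight_le {r : V} {φ : Caterpillar n → V} (hφ : G.IsCaterpillar r φ)
    (hn : 1 ≤ n) {p : V → ℕ} (hp : ¬ G.CanPebble p r) :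
    ∑ x, capWeight x * p (φ x) ≤ 2 ^ (n + 1) + 2 * n - 3 := by
  have hroot := hφ.map_root
  have := sum_weight_le_of_not_canPebble hφ.injective (root n) spineWeight (p := p) ?_
    (by rwa [hroot])
  · have hs := sum_spineWeight hn
    have hr : spineWeight (root n) = 2 ^ (n + 1) := rfl
    have hle : ∑ x, capWeight x * p (φ x) ≤ ∑ x, spineWeight x * p (φ x) := by
      refine Finset.sum_le_sum fun x _ => Nat.mul_le_mul_right _ ?_
      rcases x with t | j
      · exact ite_le_two_pow _
      · exact le_rfl
    rw [pow_succ 2 (n + 1)] at hs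
    omega
  · rintro (⟨t, ht⟩ | j) hx -
    · have ht' : t < n + 1 := by
        by_contra h
        obtain rfl : t = n + 1 := by omega
        exact hx rfl
      refine ⟨_, hφ.adj_spine t ht', ?_⟩
      simp only [spineWeight]
      rw [pow_succ, mul_comm]
    · refine ⟨_, hφ.adj_leaf j, ?_⟩
      simp only [spineWeight, pow_add]
      have := Nat.one_le_two_pow (n := j.val)
      omega

theorem HasCaterpillarCover.canPebble [Fintype V] {r : V} (h : G.HasCaterpillarCover r n)
    (hn : 1 ≤ n) {p : V → ℕ} (hp : 2 ^ (n + 1) + 2 * n - 2 ≤ ∑ x, p x) : G.CanPebble p r := by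
  obtain ⟨φ, hφ, hcov⟩ := h
  by_contra hnot
  have h1 := two_mul_sum_le_of_cover hcov p
  have h2 := Finset.sum_le_sum fun τ (_ : τ ∈ Finset.univ) => (hφ τ).sum_capWeight_le hn hnot
  rw [Finset.sum_const, Finset.card_univ, Fintype.card_bool, smul_eq_mul] at h2
  have : 2 ≤ 2 ^ (n + 1) := by
    rw [pow_succ]; have := Nat.one_le_two_pow (n := n); omega
  omega

/-- The route to the root: below row `h` move in the second factor, on the row in the first, and
from the end of the row in the second again. A leaf of the first factor is left only on row `h`. -/
theorem IsCaterpillar.exists_two_mul_rowWeight_le {r : V} {s : W} {φ : Caterpillar n → V}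
    {ψ : Caterpillar m → W} (hφ : G.IsCaterpillar r φ) (hψ : H.IsCaterpillar s ψ) {h : ℕ}
    (hh : h ≤ m + 1) (x : Caterpillar n × Caterpillar m) (hx : x ≠ (root n, root m))
    (hw : rowWeight h x ≠ 0) :
    ∃ y, (G.boxProd H).Adj (Prod.map φ ψ x) (Prod.map φ ψ y) ∧
      2 * rowWeight h x ≤ rowWeight h y := by
  obtain ⟨⟨t, ht⟩ | i, ⟨b, hb⟩ | j⟩ := x
  · rcases lt_trichotomy b h with hbh | hbh | hbh
    · refine ⟨(.inl ⟨t, ht⟩, .inl ⟨b + 1, by omega⟩), .inr ⟨hψ.adj_spine b (by omega), rfl⟩, ?_⟩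
      simp only [rowWeight]
      rw [if_pos hbh]
      by_cases hb' : b + 1 < h
      · rw [if_pos hb', pow_succ, mul_comm 2, mul_assoc]
      · have hb1 : b + 1 = h := by omega
        rw [if_neg hb', if_pos hb1, ← hb1, pow_add 2 t, pow_succ, mul_comm 2, mul_assoc]
        exact Nat.mul_le_mul_right _ (ite_le_two_pow t)
    · subst hbh
      by_cases ht' : t < n + 1
      · refine ⟨(.inl ⟨t + 1, by omega⟩, .inl ⟨b, hb⟩), .inl ⟨hφ.adj_spine t ht', rfl⟩, ?_⟩
        simp only [rowWeight, lt_irrefl, if_false, if_true]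
        rw [← pow_succ']
        exact Nat.pow_le_pow_right (by norm_num) (by omega)
      · obtain rfl : t = n + 1 := by omega
        have hb' : b < m + 1 := by
          by_contra hlt
          obtain rfl : b = m + 1 := by omega
          exact hx rfl
        refine ⟨(.inl ⟨n + 1, ht⟩, .inl ⟨b + 1, by omega⟩), .inr ⟨hψ.adj_spine b hb', rfl⟩, ?_⟩
        simp only [rowWeight, lt_irrefl, if_false, if_true]
        rw [if_neg (by omega), if_neg (by omega), ← pow_succ']
        exact Nat.pow_le_pow_right (by norm_num) (by omega)
    · simp only [rowWeight, ne_eq] at hw hx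
      rw [if_neg (by omega), if_neg (by omega)] at hw
      obtain rfl : t = n + 1 := by
        by_contra hne
        exact hw (if_neg hne)
      have hb' : b < m + 1 := by
        by_contra hlt
        obtain rfl : b = m + 1 := by omega
        exact hx rfl
      refine ⟨(.inl ⟨n + 1, ht⟩, .inl ⟨b + 1, by omega⟩), .inr ⟨hψ.adj_spine b hb', rfl⟩, ?_⟩
      simp only [rowWeight, if_true]
      rw [if_neg (by omega), if_neg (by omega), if_neg (by omega), if_neg (by omega), ← pow_succ']
      exact Nat.pow_le_pow_right (by norm_num) (by omega)
  · have hj : j.val + 1 < h := by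
      by_contra hlt
      exact hw (if_neg hlt)
    refine ⟨(.inl ⟨t, ht⟩, .inl ⟨j.val + 2, by omega⟩), .inr ⟨hψ.adj_leaf j, rfl⟩, ?_⟩
    simp only [rowWeight]
    rw [if_pos hj]
    by_cases hj' : j.val + 2 < h
    · rw [if_pos hj', pow_succ _ (j.val + 1), mul_comm 2, mul_assoc]
    · have hj1 : j.val + 2 = h := by omega
      rw [if_neg hj', if_pos hj1, ← hj1, pow_add 2 t, pow_succ _ (j.val + 1), mul_comm 2, mul_assoc]
      exact Nat.mul_le_mul_right _ (ite_le_two_pow t)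
  · have hbh : b ≤ h := by
      by_contra hlt
      exact hw (if_neg hlt)
    by_cases hb' : b < h
    · refine ⟨(.inr i, .inl ⟨b + 1, by omega⟩), .inr ⟨hψ.adj_spine b (by omega), rfl⟩, ?_⟩
      simp only [rowWeight]
      rw [if_pos hbh, if_pos (by omega), ← pow_succ']
    · obtain rfl : b = h := by omega
      refine ⟨(.inl ⟨i.val + 2, by omega⟩, .inl ⟨b, hb⟩), .inl ⟨hφ.adj_leaf i, rfl⟩, ?_⟩
      simp only [rowWeight, lt_irrefl, if_false, if_true, le_refl]
      rw [← pow_succ']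
      exact Nat.pow_le_pow_right (by norm_num) (by omega)
  · have hj : j.val + 1 < h := by
      by_contra hlt
      exact hw (if_neg hlt)
    refine ⟨(.inr i, .inl ⟨j.val + 2, by omega⟩), .inr ⟨hψ.adj_leaf j, rfl⟩, ?_⟩
    simp only [rowWeight]
    rw [if_pos hj, if_pos (by omega), ← pow_succ']

/-- The row inequalities are added with coefficients `2 ^ (m - h)`, whose sum `2 ^ (m - 1)` is then
cancelled. No single row suffices: a low one gives no weight to most of the product, a high one has
an error of order `n * 2 ^ m`. -/
theorem IsCaterpillar.sum_capWeight_mul_le {r : V} {s : W} {φ : Caterpillar n → V}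
    {ψ : Caterpillar m → W} (hφ : G.IsCaterpillar r φ) (hψ : H.IsCaterpillar s ψ)
    (hn : 1 ≤ n) (hm : 1 ≤ m) {p : V × W → ℕ} (hp : ¬ (G.boxProd H).CanPebble p (r, s)) :
    ∑ y, ∑ x, capWeight x * (capWeight y * p (φ x, ψ y)) ≤
      2 ^ (n + m + 2) + 10 * n * (2 * m + 2) := by
  have hrow : ∀ h ∈ Finset.Ico 2 (m + 2),
      ∑ x, rowWeight h x * p (Prod.map φ ψ x) ≤ 2 ^ (n + m + 2) + 10 * n * 2 ^ h := by
    intro h hh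
    have hh' : h ≤ m + 1 := by have := Finset.mem_Ico.1 hh; omega
    have hle := sum_weight_le_of_not_canPebble (hφ.injective.prodMap hψ.injective)
      (root n, root m) (rowWeight h) (hφ.exists_two_mul_rowWeight_le hψ hh') (p := p)
      (by rw [Prod.map_apply, hφ.map_root, hψ.map_root]; exact hp)
    have hroot : rowWeight h (root n, root m) = 2 ^ (n + m + 2) := by
      simp only [rowWeight, root, Fin.val_last, if_true]
      rw [if_neg (by omega)]
      split_ifs with hm'
      · rw [← hm']; congr 1; omega
      · congr 1; omega
    have := sum_rowWeight_le hn hh'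
    omega
  have hsum := Finset.sum_le_sum fun h hh => Nat.mul_le_mul_left (2 ^ (m - h)) (hrow h hh)
  refine Nat.le_of_mul_le_mul_left ?_ (Nat.two_pow_pos (m - 1))
  calc 2 ^ (m - 1) * ∑ y, ∑ x, capWeight x * (capWeight y * p (φ x, ψ y))
      ≤ ∑ y, ∑ x, (∑ h ∈ Finset.Ico 2 (m + 2), 2 ^ (m - h) * cutWeight h y) *
          (capWeight x * p (φ x, ψ y)) := by
        simp only [Finset.mul_sum]
        refine Finset.sum_le_sum fun y _ => Finset.sum_le_sum fun x _ => ?_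
        calc 2 ^ (m - 1) * (capWeight x * (capWeight y * p (φ x, ψ y)))
            = (2 ^ (m - 1) * capWeight y) * (capWeight x * p (φ x, ψ y)) := by ring
          _ ≤ _ := Nat.mul_le_mul_right _ (le_sum_cutWeight hm y)
    _ = ∑ h ∈ Finset.Ico 2 (m + 2), 2 ^ (m - h) *
          ∑ x : Caterpillar n × Caterpillar m,
            (capWeight x.1 * cutWeight h x.2) * p (Prod.map φ ψ x) := by
        simp only [Fintype.sum_prod_type_right, Finset.mul_sum, Finset.sum_mul]
        symm
        rw [Finset.sum_comm]
        refine Finset.sum_congr rfl fun y _ => ?_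
        rw [Finset.sum_comm]
        refine Finset.sum_congr rfl fun x _ => Finset.sum_congr rfl fun h _ => ?_
        rw [Prod.map_apply]
        ring
    _ ≤ ∑ h ∈ Finset.Ico 2 (m + 2), 2 ^ (m - h) *
          ∑ x : Caterpillar n × Caterpillar m, rowWeight h x * p (Prod.map φ ψ x) :=
        Finset.sum_le_sum fun h _ => Nat.mul_le_mul_left _ (Finset.sum_le_sum fun x _ =>
          Nat.mul_le_mul_right _ (capWeight_mul_cutWeight_le h x.1 x.2))
    _ ≤ _ := hsum
    _ = (∑ h ∈ Finset.Ico 2 (m + 2), 2 ^ (m - h)) * 2 ^ (n + m + 2) +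
          10 * n * ∑ h ∈ Finset.Ico 2 (m + 2), 2 ^ (m - h) * 2 ^ h := by
        rw [Finset.sum_mul, Finset.mul_sum, ← Finset.sum_add_distrib]
        exact Finset.sum_congr rfl fun h _ => by ring
    _ = 2 ^ (m - 1) * (2 ^ (n + m + 2) + 10 * n * (2 * m + 2)) := by
        rw [sum_Ico_two_pow_sub (by omega), sum_Ico_two_pow_sub_mul_two_pow hm,
          show m + 1 - 2 = m - 1 by omega]
        ring

theorem HasCaterpillarCover.sum_le_of_not_canPebble_boxProd [Fintype V] [Fintype W] {r : V} {s : W}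
    (hG : G.HasCaterpillarCover r n) (hH : H.HasCaterpillarCover s m) (hn : 1 ≤ n) (hm : 1 ≤ m)
    {p : V × W → ℕ} (hp : ¬ (G.boxProd H).CanPebble p (r, s)) :
    ∑ x, p x ≤ 2 ^ (n + m + 2) + 10 * n * (2 * m + 2) := by
  obtain ⟨φ, hφ, hφc⟩ := hG
  obtain ⟨ψ, hψ, hψc⟩ := hH
  -- The covering inequality is applied in each factor, so four pairs of caterpillars share a factor
  -- `4`.
  have h1 : 2 * ∑ w, (2 * ∑ v, p (v, w)) ≤
      ∑ σ, ∑ y, capWeight y * ∑ τ, ∑ x, capWeight x * p (φ τ x, ψ σ y) :=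
    (two_mul_sum_le_of_cover hψc _).trans <| Finset.sum_le_sum fun σ _ =>
      Finset.sum_le_sum fun y _ => Nat.mul_le_mul_left _ (two_mul_sum_le_of_cover hφc _)
  have h2 : ∑ σ, ∑ y, capWeight y * ∑ τ, ∑ x, capWeight x * p (φ τ x, ψ σ y) =
      ∑ σ, ∑ τ, ∑ y, ∑ x, capWeight x * (capWeight y * p (φ τ x, ψ σ y)) := by
    refine Finset.sum_congr rfl fun σ _ => ?_
    rw [Finset.sum_comm]
    refine Finset.sum_congr rfl fun y _ => ?_
    rw [Finset.mul_sum]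
    refine Finset.sum_congr rfl fun τ _ => ?_
    rw [Finset.mul_sum]
    exact Finset.sum_congr rfl fun x _ => by ring
  have h3 : ∑ σ, ∑ τ, ∑ y, ∑ x, capWeight x * (capWeight y * p (φ τ x, ψ σ y)) ≤
      ∑ _σ : Bool, ∑ _τ : Bool, (2 ^ (n + m + 2) + 10 * n * (2 * m + 2)) :=
    Finset.sum_le_sum fun σ _ => Finset.sum_le_sum fun τ _ =>
      (hφ τ).sum_capWeight_mul_le (hψ σ) hn hm hp
  simp only [Finset.sum_const, Finset.card_univ, Fintype.card_bool, smul_eq_mul] at h3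
  rw [← Finset.mul_sum] at h1
  rw [Fintype.sum_prod_type_right]
  omega

theorem pebbling_numbers_mul_slack {n m : ℕ} (hn : 5 ≤ n) (hm : 5 ≤ m) :
    2 ^ (n + m + 2) + 10 * n * (2 * m + 2) <
      (2 ^ (n + 1) + 2 * n - 2) * (2 ^ (m + 1) + 2 * m - 2) := by
  -- With `12 * k ≤ 2 ^ (k + 1)`, which fails at `k = 4`, the cross terms `a * (2 * m - 2) + b * (2
  -- * n - 2)` are at least `48 * n * m - 24 * n - 24 * m`, against an error of `20 * n * m + 20 *
  -- n`.
  have key : ∀ k : ℕ, 5 ≤ k → 12 * k ≤ 2 ^ (k + 1) := by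
    intro k hk
    induction k, hk using Nat.le_induction with
    | base => norm_num
    | succ k hk ih => rw [pow_succ]; omega
  have h1 := key n hn
  have h2 := key m hm
  rw [show n + m + 2 = (n + 1) + (m + 1) by omega, pow_add 2 (n + 1) (m + 1)]
  generalize 2 ^ (n + 1) = a at *
  generalize 2 ^ (m + 1) = b at *
  obtain ⟨i, rfl⟩ := Nat.exists_eq_add_of_le hn
  obtain ⟨j, rfl⟩ := Nat.exists_eq_add_of_le hm
  rw [show a + 2 * (5 + i) - 2 = a + (2 * i + 8) by omega,
    show b + 2 * (5 + j) - 2 = b + (2 * j + 8) by omega]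
  nlinarith [Nat.mul_le_mul_right (2 * j + 8) h1, Nat.mul_le_mul_right (2 * i + 8) h2]

end SimpleGraph

/-! ### Integer coordinates on the middle graph of a cycle -/

namespace SimpleGraph

open Caterpillar

theorem cycleGraph_adj_iff_val {k : ℕ} (hk : 3 ≤ k) {u v : Fin k} :
    (cycleGraph k).Adj u v ↔ u.val + 1 = v.val ∨ v.val + 1 = u.val ∨
      (u.val = 0 ∧ v.val + 1 = k) ∨ (v.val = 0 ∧ u.val + 1 = k) := by
  have hu := u.isLt
  have hv := v.isLt
  rw [cycleGraph_adj']
  rcases lt_trichotomy u v with h | h | h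
  · rw [Fin.coe_sub_iff_lt.2 h, Fin.coe_sub_iff_le.2 h.le]
    have : u.val < v.val := h
    omega
  · subst h
    rw [Fin.coe_sub_iff_le.2 le_rfl]
    omega
  · rw [Fin.coe_sub_iff_lt.2 h, Fin.coe_sub_iff_le.2 h.le]
    have : v.val < u.val := h
    omega

/-- Adjacency of positions. -/
def PositionAdj : Bool × ℤ → Bool × ℤ → Prop
  | (false, _), (false, _) => False
  | (false, z), (true, w) => z = w ∨ z = w + 1
  | (true, w), (false, z) => z = w ∨ z = w + 1
  | (true, z), (true, w) => z = w + 1 ∨ w = z + 1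

/-- The reflection of positions about `c / 2`. -/
def reflectPosition (c : ℤ) (a : Bool × ℤ) : Bool × ℤ := (a.1, c - a.2 - if a.1 then 1 else 0)

theorem reflectPosition_injective (c : ℤ) : Function.Injective (reflectPosition c) := by
  rintro ⟨a, z⟩ ⟨b, w⟩ h
  simp only [reflectPosition, Prod.mk.injEq] at h
  obtain ⟨rfl, h⟩ := h
  simp only [Prod.mk.injEq, true_and]
  omega

theorem PositionAdj.reflect {a b : Bool × ℤ} (h : PositionAdj a b) (c : ℤ) :
    PositionAdj (reflectPosition c a) (reflectPosition c b) := by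
  obtain ⟨_ | _, z⟩ := a <;> obtain ⟨_ | _, w⟩ := b <;>
    simp [PositionAdj, reflectPosition] at h ⊢ <;> omega

/-- A caterpillar of positions in a window of `n + 1` integers. -/
structure IsPositionCaterpillar {n : ℕ} (z : ℤ) (f : Caterpillar n → Bool × ℤ) : Prop where
  injective : Function.Injective f
  window : ∀ x, z ≤ (f x).2 ∧ (f x).2 ≤ z + n
  adj_spine : ∀ t (ht : t < n + 1), PositionAdj (f (.inl ⟨t, by omega⟩)) (f (.inl ⟨t + 1, by omega⟩))
  adj_leaf : ∀ j : Fin (n - 1), PositionAdj (f (.inr j)) (f (.inl ⟨j.val + 2, by omega⟩))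

section MiddleVertex

variable {k : ℕ}

/-- The residue of an integer modulo `k`, as a vertex of the cycle. -/
def cycleVertex (hk : 3 ≤ k) (z : ℤ) : Fin k :=
  ⟨(z % k).toNat, by
    have h1 := Int.emod_nonneg z (b := k) (by omega)
    have h2 := Int.emod_lt_of_pos z (b := k) (by omega)
    omega⟩

variable (hk : 3 ≤ k)

theorem cycleVertex_eq_iff {z w : ℤ} : cycleVertex hk z = cycleVertex hk w ↔ (k : ℤ) ∣ z - w := by
  have h1 := Int.emod_nonneg z (b := k) (by omega)
  have h2 := Int.emod_nonneg w (b := k) (by omega)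
  rw [Int.dvd_iff_emod_eq_zero, ← Int.emod_eq_emod_iff_emod_sub_eq_zero]
  simp only [cycleVertex, Fin.mk.injEq]
  omega

theorem cycleVertex_natCast {a : ℕ} (ha : a < k) : cycleVertex hk a = ⟨a, ha⟩ := by
  simp only [cycleVertex, Fin.mk.injEq]
  rw [Int.emod_eq_of_lt (by omega) (by omega)]
  omega

theorem cycleVertex_val (u : Fin k) : cycleVertex hk u.val = u := cycleVertex_natCast hk u.isLt

theorem cycleGraph_adj_cycleVertex (z : ℤ) :
    (cycleGraph k).Adj (cycleVertex hk z) (cycleVertex hk (z + 1)) := by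
  set u := cycleVertex hk z with hu
  have hu' : (k : ℤ) ∣ z - u.val := by
    rw [← cycleVertex_eq_iff hk, cycleVertex_val]
  rw [cycleGraph_adj_iff_val hk]
  rcases Nat.lt_or_ge (u.val + 1) k with h | h
  · have : cycleVertex hk (z + 1) = ⟨u.val + 1, h⟩ := by
      rw [← cycleVertex_natCast hk h, cycleVertex_eq_iff]
      push_cast
      simpa using hu'
    rw [this]
    exact .inl rfl
  · have hlt := u.isLt
    have : cycleVertex hk (z + 1) = ⟨0, by omega⟩ := by
      rw [← cycleVertex_natCast hk (show 0 < k by omega), cycleVertex_eq_iff]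
      have h1 : z + 1 - ((0 : ℕ) : ℤ) = (z - u.val) + k := by omega
      rw [h1]
      exact dvd_add hu' dvd_rfl
    rw [this]
    exact .inr (.inr (.inr ⟨rfl, by omega⟩))

/-- The edge of the cycle from the residue of `z` to that of `z + 1`. -/
def cycleEdge (z : ℤ) : (cycleGraph k).edgeSet :=
  ⟨s(cycleVertex hk z, cycleVertex hk (z + 1)), cycleGraph_adj_cycleVertex hk z⟩

theorem cycleEdge_eq_iff {z w : ℤ} : cycleEdge hk z = cycleEdge hk w ↔ (k : ℤ) ∣ z - w := by
  rw [Subtype.ext_iff]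
  simp only [cycleEdge, Sym2.eq_iff, cycleVertex_eq_iff]
  constructor
  · rintro (h | ⟨h1, h2⟩)
    · exact h.1
    · have h3 : (k : ℤ) ∣ 2 := by
        have := dvd_sub h2 h1
        rwa [show z + 1 - w - (z - (w + 1)) = 2 by ring] at this
      have := Int.le_of_dvd (by norm_num) h3
      omega
  · intro h
    exact .inl ⟨h, by rwa [add_sub_add_right_eq_sub]⟩

theorem exists_cycleEdge_eq (e : (cycleGraph k).edgeSet) : ∃ z, cycleEdge hk z = e := by
  obtain ⟨e, he⟩ := e
  induction e using Sym2.ind with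
  | _ u v =>
  have key : ∀ u v : Fin k, (k : ℤ) ∣ u.val + 1 - v.val →
      (cycleEdge hk u.val : Sym2 (Fin k)) = s(u, v) := by
    intro u v h
    rw [← cycleVertex_eq_iff hk, cycleVertex_val] at h
    simp only [cycleEdge, cycleVertex_val, h]
  have hadj : (cycleGraph k).Adj u v := he
  rw [cycleGraph_adj_iff_val hk] at hadj
  rcases hadj with h | h | ⟨h1, h2⟩ | ⟨h1, h2⟩
  · exact ⟨u.val, Subtype.ext (key u v (by rw [← h]; simp))⟩
  · exact ⟨v.val, Subtype.ext ((key v u (by rw [← h]; simp)).trans Sym2.eq_swap)⟩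
  · refine ⟨v.val, Subtype.ext ((key v u ?_).trans Sym2.eq_swap)⟩
    rw [h1, ← Nat.cast_succ, Nat.succ_eq_add_one, h2]; simp
  · refine ⟨u.val, Subtype.ext (key u v ?_)⟩
    rw [h1, ← Nat.cast_succ, Nat.succ_eq_add_one, h2]; simp

/-- The vertex of the middle graph of the cycle at a position: an original vertex at `(false, z)`
and the vertex of the edge from `z` to `z + 1` at `(true, z)`. -/
def middleVertex : Bool × ℤ → Fin k ⊕ (cycleGraph k).edgeSet
  | (false, z) => .inl (cycleVertex hk z)
  | (true, z) => .inr (cycleEdge hk z)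

theorem middleVertex_eq_iff {a b : Bool × ℤ} :
    middleVertex hk a = middleVertex hk b ↔ a.1 = b.1 ∧ (k : ℤ) ∣ a.2 - b.2 := by
  obtain ⟨_ | _, z⟩ := a <;> obtain ⟨_ | _, w⟩ := b <;>
    simp [middleVertex, cycleVertex_eq_iff, cycleEdge_eq_iff]

theorem exists_middleVertex_eq (g : Fin k ⊕ (cycleGraph k).edgeSet) (z₀ : ℤ) :
    ∃ b d, 0 ≤ d ∧ d < (k : ℤ) ∧ middleVertex hk (b, z₀ + d) = g := by
  obtain ⟨⟨b, z⟩, h⟩ : ∃ a, middleVertex hk a = g := by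
    rcases g with u | e
    · exact ⟨(false, u.val), congrArg Sum.inl (cycleVertex_val hk u)⟩
    · obtain ⟨z, hz⟩ := exists_cycleEdge_eq hk e
      exact ⟨(true, z), congrArg Sum.inr hz⟩
  refine ⟨b, (z - z₀) % k, Int.emod_nonneg _ (by omega), Int.emod_lt_of_pos _ (by omega), ?_⟩
  rw [← h, middleVertex_eq_iff]
  refine ⟨rfl, ?_⟩
  have : z₀ + (z - z₀) % k - z = -(z - z₀ - (z - z₀) % k) := by ring
  rw [this, dvd_neg]
  exact Int.dvd_self_sub_emod

theorem PositionAdj.middleGraph_adj {a b : Bool × ℤ} (h : PositionAdj a b) :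
    (cycleGraph k).middleGraph.Adj (middleVertex hk a) (middleVertex hk b) := by
  have hve : ∀ z w : ℤ, z = w ∨ z = w + 1 →
      cycleVertex hk z ∈ (cycleEdge hk w : Sym2 (Fin k)) := by
    rintro z w (rfl | rfl)
    · exact Sym2.mem_mk_left _ _
    · exact Sym2.mem_mk_right _ _
  have hee : ∀ z, (cycleGraph k).middleGraph.Adj (.inr (cycleEdge hk z))
      (.inr (cycleEdge hk (z + 1))) := by
    intro z
    refine ⟨fun h => ?_, cycleVertex hk (z + 1), hve _ _ (.inr rfl), hve _ _ (.inl rfl)⟩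
    rw [cycleEdge_eq_iff] at h
    have h1 : (k : ℤ) ∣ 1 := by
      rw [← dvd_neg]
      rwa [show z - (z + 1) = -1 by ring] at h
    have := Int.le_of_dvd (by norm_num) h1
    omega
  obtain ⟨_ | _, z⟩ := a <;> obtain ⟨_ | _, w⟩ := b <;> simp only [PositionAdj] at h
  · exact hve z w h
  · exact hve w z h
  · rcases h with rfl | rfl
    · exact (hee w).symm
    · exact hee z

/-- Positions in the window differ by at most `n < k`, so reduction modulo `k` stays injective on
the caterpillar. -/
theorem IsPositionCaterpillar.isCaterpillar {n : ℕ} (hn : n + 1 < k) {z : ℤ}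
    {f : Caterpillar n → Bool × ℤ} (h : IsPositionCaterpillar z f) :
    (cycleGraph k).middleGraph.IsCaterpillar (middleVertex hk (f (root n)))
      (fun x => middleVertex hk (f x)) where
  injective x y hxy := by
    rw [middleVertex_eq_iff] at hxy
    refine h.injective (Prod.ext hxy.1 ?_)
    have h1 := h.window x
    have h2 := h.window y
    have := Int.eq_zero_of_abs_lt_dvd hxy.2 (by rw [abs_lt]; omega)
    omega
  map_root := rfl
  adj_spine t ht := (h.adj_spine t ht).middleGraph_adj hk
  adj_leaf j := (h.adj_leaf j).middleGraph_adj hk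

theorem IsPositionCaterpillar.isCaterpillar_reflect {n : ℕ} (hn : n + 1 < k) {z : ℤ}
    {f : Caterpillar n → Bool × ℤ} (h : IsPositionCaterpillar z f) (c : ℤ)
    (hc : reflectPosition c (f (root n)) = f (root n)) :
    (cycleGraph k).middleGraph.IsCaterpillar (middleVertex hk (f (root n)))
      (fun x => middleVertex hk (reflectPosition c (f x))) where
  injective x y hxy := by
    rw [middleVertex_eq_iff] at hxy
    refine h.injective (reflectPosition_injective c (Prod.ext hxy.1 ?_))
    have h1 := h.window x
    have h2 := h.window y
    have hb : (f x).1 = (f y).1 := hxy.1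
    have h3 := hxy.2
    simp only [reflectPosition, hb] at h3 ⊢
    have := Int.eq_zero_of_abs_lt_dvd h3 (by rw [abs_lt]; split_ifs <;> omega)
    omega
  map_root := by rw [hc]
  adj_spine t ht := ((h.adj_spine t ht).reflect c).middleGraph_adj hk
  adj_leaf j := ((h.adj_leaf j).reflect c).middleGraph_adj hk

end MiddleVertex

/-! ### Caterpillar covers for both kinds of root -/

section Covers

variable {n : ℕ}

/-- The caterpillar of positions with root at the original vertex `z`. -/
def vertexCaterpillar (z : ℤ) : Caterpillar n → Bool × ℤ
  | .inl t => if t.val = n + 1 then (false, z) else if t.val = 0 then (false, z + n)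
      else (true, z + n - t.val)
  | .inr j => (false, z + n - 1 - j.val)

/-- The caterpillar of positions with root at the edge from `z` to `z + 1`. -/
def edgeCaterpillar (z : ℤ) : Caterpillar n → Bool × ℤ
  | .inl t => if t.val = 0 then (true, z + n) else if t.val = 1 then (false, z + n)
      else (true, z + n + 1 - t.val)
  | .inr j => (false, z + n - 1 - j.val)

theorem isPositionCaterpillar_vertexCaterpillar (hn : 1 ≤ n) (z : ℤ) :
    IsPositionCaterpillar z (vertexCaterpillar z : Caterpillar n → Bool × ℤ) where
  injective := by
    rintro (⟨t, ht⟩ | ⟨j, hj⟩) (⟨t', ht'⟩ | ⟨j', hj'⟩) h <;> simp only [vertexCaterpillar] at h <;>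
      (try split_ifs at h) <;> simp at h ⊢ <;> omega
  window := by
    rintro (⟨t, ht⟩ | ⟨j, hj⟩) <;> simp only [vertexCaterpillar] <;> (try split_ifs) <;>
      constructor <;> (try dsimp only) <;> omega
  adj_spine t ht := by
    simp only [vertexCaterpillar]
    split_ifs <;> simp only [PositionAdj] <;> first | contradiction | omega
  adj_leaf := by
    rintro ⟨j, hj⟩
    simp only [vertexCaterpillar]
    split_ifs <;> simp only [PositionAdj] <;> first | contradiction | omega

/-- The spine detours through `(false, z + n)` between two adjacent edge vertices. This gives it the
same length as for an original root and covers that vertex. -/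
theorem isPositionCaterpillar_edgeCaterpillar (hn : 1 ≤ n) (z : ℤ) :
    IsPositionCaterpillar z (edgeCaterpillar z : Caterpillar n → Bool × ℤ) where
  injective := by
    rintro (⟨t, ht⟩ | ⟨j, hj⟩) (⟨t', ht'⟩ | ⟨j', hj'⟩) h <;> simp only [edgeCaterpillar] at h <;>
      (try split_ifs at h) <;> simp at h ⊢ <;> omega
  window := by
    rintro (⟨t, ht⟩ | ⟨j, hj⟩) <;> simp only [edgeCaterpillar] <;> (try split_ifs) <;>
      constructor <;> (try dsimp only) <;> omega
  adj_spine t ht := by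
    simp only [edgeCaterpillar]
    split_ifs <;> simp only [PositionAdj] <;> first | contradiction | omega | simp_all
  adj_leaf := by
    rintro ⟨j, hj⟩
    simp only [edgeCaterpillar]
    split_ifs <;> simp only [PositionAdj] <;> first | contradiction | omega

theorem vertexCaterpillar_root (z : ℤ) : vertexCaterpillar z (root n) = (false, z) := by
  simp [vertexCaterpillar, root]

theorem edgeCaterpillar_root (hn : 1 ≤ n) (z : ℤ) : edgeCaterpillar z (root n) = (true, z) := by
  have : n ≠ 0 := by omega
  simp [edgeCaterpillar, root, this]

theorem capWeight_inl {t : ℕ} (ht : t < n + 2) (h : t ≠ 0) :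
    capWeight (.inl ⟨t, ht⟩ : Caterpillar n) = 2 := if_neg h

/-- The window `z + d` with `0 ≤ d < 2 * n` represents each residue once. The mirror image extends
below the root, hence the shift by `2 * n`; the last alternative is the far end, where the two
caterpillars meet. -/
theorem hasCaterpillarCover_of_positions (hn : 2 ≤ n) (hk : 3 ≤ 2 * n) {z c : ℤ}
    {f : Caterpillar n → Bool × ℤ} (hf : IsPositionCaterpillar z f)
    (hc : reflectPosition c (f (root n)) = f (root n))
    (hcov : ∀ b (d : ℤ), 0 ≤ d → d < 2 * n →
      (∃ x, f x = (b, z + d) ∧ capWeight x = 2) ∨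
      (∃ x, (reflectPosition c (f x) = (b, z + d - 2 * n) ∨ reflectPosition c (f x) = (b, z + d)) ∧
        capWeight x = 2) ∨
      (f (.inl 0) = (b, z + d) ∧ reflectPosition c (f (.inl 0)) = (b, z + d - 2 * n))) :
    (cycleGraph (2 * n)).middleGraph.HasCaterpillarCover (middleVertex hk (f (root n))) n := by
  refine ⟨fun τ x => middleVertex hk (if τ then f x else reflectPosition c (f x)), ?_, ?_⟩
  · rintro (_ | _)
    · exact hf.isCaterpillar_reflect hk (by omega) c hc
    · exact hf.isCaterpillar hk (by omega)
  · intro g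
    obtain ⟨b, d, h0, h1, rfl⟩ := exists_middleVertex_eq hk g z
    have hshift : middleVertex hk (b, z + d - 2 * n) = middleVertex hk (b, z + d) := by
      rw [middleVertex_eq_iff]
      exact ⟨rfl, -1, by push_cast; ring⟩
    rcases hcov b d h0 (by push_cast at h1; omega) with ⟨x, hx, hx2⟩ | ⟨x, hx | hx, hx2⟩ | ⟨hx, hx'⟩
    · exact .inl ⟨true, x, congrArg _ hx, hx2⟩
    · exact .inl ⟨false, x, (congrArg _ hx).trans hshift, hx2⟩
    · exact .inl ⟨false, x, congrArg _ hx, hx2⟩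
    · refine .inr ?_
      rintro (_ | _)
      · exact (congrArg _ hx').trans hshift
      · exact congrArg _ hx

theorem hasCaterpillarCover_middleGraph_cycleGraph (hn : 2 ≤ n)
    (g : Fin (2 * n) ⊕ (cycleGraph (2 * n)).edgeSet) :
    (cycleGraph (2 * n)).middleGraph.HasCaterpillarCover g n := by
  have hk : 3 ≤ 2 * n := by omega
  obtain ⟨_ | _, z, -, -, rfl⟩ := exists_middleVertex_eq hk g 0
  · rw [← vertexCaterpillar_root (n := n) (0 + z)]
    refine hasCaterpillarCover_of_positions hn hk (c := 2 * (0 + z))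
      (isPositionCaterpillar_vertexCaterpillar (by omega) _) ?_ ?_
    · rw [vertexCaterpillar_root]
      simp [reflectPosition]; ring
    · generalize 0 + z = z
      rintro (_ | _) d h0 h1
      · rcases lt_trichotomy d n with h | rfl | h
        · rcases h0.eq_or_lt with rfl | h0
          · exact .inl ⟨root n, by rw [vertexCaterpillar_root, add_zero], capWeight_inl _ (by omega)⟩
          · refine .inl ⟨.inr ⟨n - 1 - d.toNat, by omega⟩, ?_, rfl⟩
            simp only [vertexCaterpillar, Prod.mk.injEq, true_and]
            omega
        · refine .inr (.inr ⟨?_, ?_⟩) <;> simp [vertexCaterpillar, reflectPosition]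
          omega
        · refine .inr (.inl ⟨.inr ⟨(d - n - 1).toNat, by omega⟩, .inl ?_, rfl⟩)
          simp [vertexCaterpillar, reflectPosition]
          omega
      · rcases lt_or_ge d n with h | h
        · refine .inl ⟨.inl ⟨n - d.toNat, by omega⟩, ?_, capWeight_inl _ (by omega)⟩
          simp only [vertexCaterpillar]
          rw [if_neg (by omega), if_neg (by omega)]
          simp only [Prod.mk.injEq, true_and]
          omega
        · refine .inr (.inl ⟨.inl ⟨(d - n + 1).toNat, by omega⟩, .inl ?_, capWeight_inl _ (by omega)⟩)
          simp only [vertexCaterpillar]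
          rw [if_neg (by omega), if_neg (by omega)]
          simp [reflectPosition]
          omega
  · rw [← edgeCaterpillar_root (n := n) (by omega) (0 + z)]
    refine hasCaterpillarCover_of_positions hn hk (c := 2 * (0 + z) + 1)
      (isPositionCaterpillar_edgeCaterpillar (by omega) _) ?_ ?_
    · rw [edgeCaterpillar_root (by omega)]
      simp [reflectPosition]; ring
    · generalize 0 + z = z
      rintro (_ | _) d h0 h1
      · rcases h0.eq_or_lt with rfl | h0
        · refine .inr (.inl ⟨.inr ⟨n - 2, by omega⟩, .inr ?_, rfl⟩)
          simp [edgeCaterpillar, reflectPosition]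
          omega
        · rcases lt_trichotomy d n with h | rfl | h
          · refine .inl ⟨.inr ⟨n - 1 - d.toNat, by omega⟩, ?_, rfl⟩
            simp only [edgeCaterpillar, Prod.mk.injEq, true_and]
            omega
          · refine .inl ⟨.inl ⟨1, by omega⟩, ?_, capWeight_inl _ (by omega)⟩
            simp [edgeCaterpillar]
          · rcases (show (n : ℤ) + 1 ≤ d from h).eq_or_lt with rfl | h
            · refine .inr (.inl ⟨.inl ⟨1, by omega⟩, .inl ?_, capWeight_inl _ (by omega)⟩)
              simp [edgeCaterpillar, reflectPosition]
              omega
            · refine .inr (.inl ⟨.inr ⟨(d - n - 2).toNat, by omega⟩, .inl ?_, rfl⟩)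
              simp [edgeCaterpillar, reflectPosition]
              omega
      · rcases lt_trichotomy d n with h | rfl | h
        · refine .inl ⟨.inl ⟨n + 1 - d.toNat, by omega⟩, ?_, capWeight_inl _ (by omega)⟩
          simp only [edgeCaterpillar]
          rw [if_neg (by omega), if_neg (by omega)]
          simp only [Prod.mk.injEq, true_and]
          omega
        · refine .inr (.inr ⟨?_, ?_⟩) <;> simp [edgeCaterpillar, reflectPosition]
          omega
        · refine .inr (.inl ⟨.inl ⟨(d - n + 1).toNat, by omega⟩, .inl ?_, capWeight_inl _ (by omega)⟩)
          simp only [edgeCaterpillar]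
          rw [if_neg (by omega), if_neg (by omega)]
          simp [reflectPosition]
          omega

end Covers

end SimpleGraph

/-! ### Lower bound by a potential -/

namespace SimpleGraph

section LowerBound

variable {V : Type*} [Fintype V] {G : SimpleGraph V}

/-- The potential of `k` pebbles on a vertex of height `h`; on a `paired` vertex, pebbles count in
pairs only. -/
def pebblePotential (h : ℕ) (paired : Prop) [Decidable paired] (k : ℕ) : ℕ :=
  2 ^ h * if paired then 2 * (k / 2) else k

theorem pebblePotential_mono (h : ℕ) (paired : Prop) [Decidable paired] :
    Monotone (pebblePotential h paired) := by
  intro a b hab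
  refine Nat.mul_le_mul_left _ ?_
  split_ifs <;> omega

/-- Pebbling moves do not increase the potential, if heights of adjacent vertices differ by at most
one and vertices in `S` are no higher than their neighbours. -/
theorem sum_pebblePotential_le_of_pebblingMove {H : V → ℕ} {S : V → Prop} [DecidablePred S]
    (hH : ∀ u w, G.Adj u w → H w ≤ H u + 1) (hS : ∀ u w, G.Adj u w → S w → H w ≤ H u)
    {p q : V → ℕ} (h : G.PebblingMove p q) :
    ∑ x, pebblePotential (H x) (S x) (q x) ≤ ∑ x, pebblePotential (H x) (S x) (p x) := by
  classical
  obtain ⟨u, w, huw, h1, h2, h3⟩ := h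
  have hsplit : ∀ f : V → ℕ, ∑ x, f x = f u + (f w + ∑ x ∈ (Finset.univ.erase u).erase w, f x) := by
    intro f
    rw [Finset.add_sum_erase _ _ (Finset.mem_erase.2 ⟨huw.ne', Finset.mem_univ w⟩),
      Finset.add_sum_erase _ _ (Finset.mem_univ u)]
  rw [hsplit, hsplit (fun x => pebblePotential (H x) (S x) (p x)), ← add_assoc, ← add_assoc]
  refine add_le_add ?_ (Finset.sum_le_sum fun x hx => ?_)
  · have hu : pebblePotential (H u) (S u) (p u) = pebblePotential (H u) (S u) (q u)
        + 2 * 2 ^ H u := by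
      rw [h1]
      simp only [pebblePotential]
      split_ifs
      · rw [Nat.add_div_right _ (by norm_num)]; ring
      · ring
    have hw : pebblePotential (H w) (S w) (q w) ≤ pebblePotential (H w) (S w) (p w)
        + 2 * 2 ^ H u := by
      rw [h2]
      simp only [pebblePotential]
      split_ifs with hs
      -- A pebble arriving at a paired vertex may complete a pair and add `2 * 2 ^ H w`; this is why
      -- such vertices may not be higher than their neighbours.
      · have := Nat.pow_le_pow_right (n := 2) (by norm_num) (hS u w huw hs)
        have h5 : 2 * ((p w + 1) / 2) ≤ 2 * (p w / 2) + 2 := by omega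
        calc 2 ^ H w * (2 * ((p w + 1) / 2)) ≤ 2 ^ H w * (2 * (p w / 2) + 2) :=
              Nat.mul_le_mul_left _ h5
          _ ≤ _ := by rw [mul_add]; omega
      · have := Nat.pow_le_pow_right (n := 2) (by norm_num) (hH u w huw)
        rw [pow_succ] at this
        rw [mul_add]
        omega
    omega
  · simp only [Finset.mem_erase] at hx
    rw [h3 x hx.2.1 hx.1]

theorem not_canPebble_of_pebblePotential_lt {H : V → ℕ} {S : V → Prop} [DecidablePred S]
    (hH : ∀ u w, G.Adj u w → H w ≤ H u + 1) (hS : ∀ u w, G.Adj u w → S w → H w ≤ H u)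
    {p : V → ℕ} {r : V} (hr : ¬ S r)
    (hp : ∑ x, pebblePotential (H x) (S x) (p x) < 2 ^ H r) : ¬ G.CanPebble p r := by
  rintro ⟨q, hq, hpos⟩
  have hle : ∑ x, pebblePotential (H x) (S x) (q x) ≤ ∑ x, pebblePotential (H x) (S x) (p x) := by
    clear hpos
    induction hq with
    | refl => exact le_rfl
    | tail _ hmove ih => exact (sum_pebblePotential_le_of_pebblingMove hH hS hmove).trans ih
  have h1 : pebblePotential (H r) (S r) (q r) ≤ ∑ x, pebblePotential (H x) (S x) (q x) :=
    Finset.single_le_sum (f := fun x => pebblePotential (H x) (S x) (q x))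
      (fun _ _ => Nat.zero_le _) (Finset.mem_univ r)
  have h2 : 2 ^ H r * 1 ≤ pebblePotential (H r) (S r) (q r) := by
    rw [pebblePotential, if_neg hr]
    exact Nat.mul_le_mul_left _ hpos
  omega

end LowerBound

/-- The infimum in `pebblingNumberAt` ranges over exact sizes, so every smaller size needs its own
failing placement, taken below the extremal one. -/
theorem exists_le_sum_eq {V : Type*} [Fintype V] (p : V → ℕ) {k : ℕ} (hk : k ≤ ∑ x, p x) :
    ∃ q ≤ p, ∑ x, q x = k := by
  classical
  induction hd : ∑ x, p x - k generalizing p with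
  | zero => exact ⟨p, le_rfl, by omega⟩
  | succ d ih =>
    obtain ⟨x, -, hx⟩ : ∃ x ∈ Finset.univ, p x ≠ 0 := by
      by_contra! h
      rw [Finset.sum_eq_zero h] at hd
      omega
    have hsum : ∑ y, Function.update p x (p x - 1) y + 1 = ∑ y, p y := by
      rw [Finset.sum_update_of_mem (Finset.mem_univ x), ← Finset.add_sum_erase _ _ (Finset.mem_univ x),
        Finset.sdiff_singleton_eq_erase]
      omega
    obtain ⟨q, hq, hqk⟩ := ih (Function.update p x (p x - 1)) (by omega) (by omega)
    exact ⟨q, hq.trans (update_le_self_iff.2 (by omega)), hqk⟩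

/-! ### The extremal placement on the middle graph of an even cycle -/

section MiddleCycle

variable {n : ℕ}

/-- The distance of a vertex of the cycle from the vertex `n`. -/
def cycleHeight (i : Fin (2 * n)) : ℕ := (n - i.val) + (i.val - n)

theorem cycleHeight_le_of_adj (hn : 2 ≤ n) {i j : Fin (2 * n)} (h : (cycleGraph (2 * n)).Adj i j) :
    cycleHeight i ≤ cycleHeight j + 1 := by
  rw [cycleGraph_adj_iff_val (by omega)] at h
  have := i.isLt
  have := j.isLt
  simp only [cycleHeight]
  omega

/-- The distance of a vertex of the middle graph of the cycle from the original vertex `n`, except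
that the original vertices other than `0` and `n` are one lower. -/
def middleHeight : Fin (2 * n) ⊕ (cycleGraph (2 * n)).edgeSet → ℕ
  | .inl i => if i.val = 0 then n + 1 else cycleHeight i
  | .inr e => (e : Sym2 (Fin (2 * n))).lift ⟨fun i j => max (cycleHeight i) (cycleHeight j),
      fun _ _ => max_comm _ _⟩

theorem middleHeight_inr_bounds (hn : 2 ≤ n) {i : Fin (2 * n)} {e : (cycleGraph (2 * n)).edgeSet}
    (h : i ∈ (e : Sym2 (Fin (2 * n)))) :
    cycleHeight i ≤ middleHeight (.inr e) ∧ middleHeight (.inr e) ≤ cycleHeight i + 1 := by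
  obtain ⟨e, he⟩ := e
  obtain ⟨j, rfl⟩ := Sym2.mem_iff_exists.1 h
  have := cycleHeight_le_of_adj hn (show (cycleGraph (2 * n)).Adj i j from he).symm
  simp only [middleHeight, Sym2.lift_mk]
  omega

theorem middleHeight_inr_le (e : (cycleGraph (2 * n)).edgeSet) : middleHeight (.inr e) ≤ n := by
  obtain ⟨e, he⟩ := e
  induction e using Sym2.ind with
  | _ i j =>
  have := i.isLt
  have := j.isLt
  simp only [middleHeight, Sym2.lift_mk, cycleHeight]
  omega

/-- The original vertices other than `0` and `n`. -/
def IsPairedVertex : Fin (2 * n) ⊕ (cycleGraph (2 * n)).edgeSet → Prop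
  | .inl i => i.val ≠ 0 ∧ i.val ≠ n
  | .inr _ => False

theorem middleHeight_le_of_adj (hn : 2 ≤ n) (u w : Fin (2 * n) ⊕ (cycleGraph (2 * n)).edgeSet)
    (h : (cycleGraph (2 * n)).middleGraph.Adj u w) : middleHeight w ≤ middleHeight u + 1 := by
  have key : ∀ (i : Fin (2 * n)) (e : (cycleGraph (2 * n)).edgeSet),
      i ∈ (e : Sym2 (Fin (2 * n))) → middleHeight (.inl i) ≤ middleHeight (.inr e) + 1 ∧
        middleHeight (.inr e) ≤ middleHeight (.inl i) + 1 := by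
    intro i e hi
    have h1 := middleHeight_inr_bounds hn hi
    have h2 := middleHeight_inr_le e
    rw [show middleHeight (.inl i) = if i.val = 0 then n + 1 else cycleHeight i from rfl]
    split_ifs with h0
    · have : cycleHeight i = n := by simp [cycleHeight, h0]
      omega
    · omega
  rcases u with i | e <;> rcases w with j | e'
  · exact h.elim
  · exact (key i e' h).2
  · exact (key j e h).1
  · obtain ⟨-, v, hv, hv'⟩ := h
    have h1 := middleHeight_inr_bounds hn hv
    have h2 := middleHeight_inr_bounds hn hv'
    omega

theorem middleHeight_le_of_adj_of_isPairedVertex (hn : 2 ≤ n)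
    (u w : Fin (2 * n) ⊕ (cycleGraph (2 * n)).edgeSet)
    (h : (cycleGraph (2 * n)).middleGraph.Adj u w) (hw : IsPairedVertex w) :
    middleHeight w ≤ middleHeight u := by
  rcases w with j | e'
  · rcases u with i | e
    · exact h.elim
    · rw [show middleHeight (.inl j) = if j.val = 0 then n + 1 else cycleHeight j from rfl,
        if_neg hw.1]
      exact (middleHeight_inr_bounds hn h).1
  · exact hw.elim

/-- The largest placement on the middle graph of the cycle that does not reach the vertex `0`. -/
def extremalPlacement : Fin (2 * n) ⊕ (cycleGraph (2 * n)).edgeSet → ℕ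
  | .inl i => if i.val = 0 then 0 else if i.val = n then 2 ^ (n + 1) - 1 else 1
  | .inr _ => 0

theorem sum_fin_extremal (hn : 1 ≤ n) (a : ℕ) :
    ∑ i : Fin (2 * n), (if i.val = 0 then 0 else if i.val = n then a else 1) + 2 = a + 2 * n := by
  rw [Fin.sum_univ_eq_sum_range (fun i => if i = 0 then 0 else if i = n then a else 1) (2 * n)]
  have : ∀ i ∈ Finset.range (2 * n), (if i = 0 then 0 else if i = n then a else 1) +
      ((if i = 0 then 1 else 0) + (if i = n then 1 else 0)) = 1 + if i = n then a else 0 := by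
    intro i _
    split_ifs <;> omega
  have := Finset.sum_congr rfl this
  simp only [Finset.sum_add_distrib, Finset.sum_ite_eq', Finset.mem_range, Finset.sum_const,
    Finset.card_range, smul_eq_mul, mul_one] at this
  rw [if_pos (by omega), if_pos (by omega), if_pos (by omega)] at this
  omega

variable [Fintype (cycleGraph (2 * n)).edgeSet]

theorem sum_extremalPlacement (hn : 1 ≤ n) :
    ∑ x : Fin (2 * n) ⊕ (cycleGraph (2 * n)).edgeSet, extremalPlacement x =
      2 ^ (n + 1) + 2 * n - 3 := by
  rw [Fintype.sum_sum_type]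
  simp only [extremalPlacement, Finset.sum_const_zero, add_zero]
  have := sum_fin_extremal hn (2 ^ (n + 1) - 1)
  have := Nat.two_pow_pos (n + 1)
  omega

theorem not_canPebble_of_le_extremalPlacement (hn : 2 ≤ n)
    {p : Fin (2 * n) ⊕ (cycleGraph (2 * n)).edgeSet → ℕ} (hp : p ≤ extremalPlacement) :
    ¬ (cycleGraph (2 * n)).middleGraph.CanPebble p (.inl ⟨0, by omega⟩) := by
  classical
  refine not_canPebble_of_pebblePotential_lt (H := middleHeight) (S := IsPairedVertex)
    (middleHeight_le_of_adj hn) (middleHeight_le_of_adj_of_isPairedVertex hn)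
    (fun h => h.1 rfl) ?_
  have hroot : middleHeight (.inl ⟨0, by omega⟩ : Fin (2 * n) ⊕ (cycleGraph (2 * n)).edgeSet) =
      n + 1 := by simp [middleHeight]
  rw [hroot]
  calc _ ≤ ∑ x, pebblePotential (middleHeight x) (IsPairedVertex x) (extremalPlacement x) :=
        Finset.sum_le_sum fun x _ => pebblePotential_mono _ _ (hp x)
    -- Single pebbles on paired vertices have potential `0`, so only the pile on vertex `n`, of
    -- height `0`, counts.
    _ = ∑ i : Fin (2 * n), if i = (⟨n, by omega⟩ : Fin (2 * n)) then 2 ^ (n + 1) - 1 else 0 := by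
        rw [Fintype.sum_sum_type]
        simp only [pebblePotential, extremalPlacement, IsPairedVertex, Nat.zero_div, mul_zero,
          ite_self, Finset.sum_const_zero, add_zero]
        refine Finset.sum_congr rfl fun i _ => ?_
        by_cases h0 : i.val = 0
        · have hne : i ≠ ⟨n, by omega⟩ := fun h => by rw [h] at h0; simp at h0; omega
          simp [h0, hne]
        · by_cases hin : i.val = n
          · have hi : i = ⟨n, by omega⟩ := Fin.ext hin
            have hn0 : n ≠ 0 := by omega
            simp [hi, hn0, middleHeight, cycleHeight]
          · have hne : i ≠ ⟨n, by omega⟩ := fun h => hin (congrArg Fin.val h)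
            simp [h0, hin, hne]
    _ = 2 ^ (n + 1) - 1 := by simp
    _ < 2 ^ (n + 1) := by have := Nat.two_pow_pos (n + 1); omega

theorem pebblingNumber_middleGraph_cycleGraph (hn : 2 ≤ n) :
    (cycleGraph (2 * n)).middleGraph.pebblingNumber = ((2 ^ (n + 1) + 2 * n - 2 : ℕ) : ℕ∞) := by
  refine le_antisymm (iSup_le fun v => ?_) ?_
  · exact iInf₂_le (2 ^ (n + 1) + 2 * n - 2) fun p hp =>
      (hasCaterpillarCover_middleGraph_cycleGraph hn v).canPebble (by omega) hp.ge
  · refine le_iSup_of_le (.inl ⟨0, by omega⟩) (le_iInf₂ fun k hk => ?_)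
    rw [Nat.cast_le]
    by_contra! hlt
    obtain ⟨q, hq, hsum⟩ := exists_le_sum_eq (V := Fin (2 * n) ⊕ (cycleGraph (2 * n)).edgeSet)
      extremalPlacement (k := k) (by rw [sum_extremalPlacement (by omega)]; omega)
    exact not_canPebble_of_le_extremalPlacement hn hq (hk q hsum)

end MiddleCycle

/-! ### The product inequality -/

theorem pebblingNumber_boxProd_middleGraph_cycleGraph_le {n m : ℕ} (hn : 5 ≤ n) (hm : 5 ≤ m)
    [Fintype (cycleGraph (2 * n)).edgeSet] [Fintype (cycleGraph (2 * m)).edgeSet] :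
    ((cycleGraph (2 * n)).middleGraph.boxProd (cycleGraph (2 * m)).middleGraph).pebblingNumber ≤
      (((2 ^ (n + 1) + 2 * n - 2) * (2 ^ (m + 1) + 2 * m - 2) : ℕ) : ℕ∞) := by
  refine iSup_le fun v => iInf₂_le _ fun p hp => ?_
  by_contra hnot
  have := (hasCaterpillarCover_middleGraph_cycleGraph (by omega) v.1).sum_le_of_not_canPebble_boxProd
    (hasCaterpillarCover_middleGraph_cycleGraph (by omega) v.2) (by omega) (by omega) hnot
  have := pebbling_numbers_mul_slack hn hm
  omega

end SimpleGraph

theorem theorem2p8 (n m : ℕ) (hn : 5 ≤ n) (hm : 5 ≤ m) (hnm : 2 ≤ |(n : ℤ) - (m : ℤ)|) :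
    (SimpleGraph.cycleGraph (2 * n)).middleGraph.pebblingNumber
        = ((2 ^ (n + 1) + 2 * n - 2 : ℕ) : ℕ∞) ∧
    (SimpleGraph.cycleGraph (2 * m)).middleGraph.pebblingNumber
        = ((2 ^ (m + 1) + 2 * m - 2 : ℕ) : ℕ∞) ∧
    ((SimpleGraph.cycleGraph (2 * n)).middleGraph.boxProd
        (SimpleGraph.cycleGraph (2 * m)).middleGraph).pebblingNumber
      ≤ (SimpleGraph.cycleGraph (2 * n)).middleGraph.pebblingNumber *
        (SimpleGraph.cycleGraph (2 * m)).middleGraph.pebblingNumber := by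
  have h1 := SimpleGraph.pebblingNumber_middleGraph_cycleGraph (n := n) (by omega)
  have h2 := SimpleGraph.pebblingNumber_middleGraph_cycleGraph (n := m) (by omega)
  refine ⟨h1, h2, ?_⟩
  rw [h1, h2, ← Nat.cast_mul]
  exact SimpleGraph.pebblingNumber_boxProd_middleGraph_cycleGraph_le hn hm
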